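/- **Conventions.** Let $\mathcal F$ be the set of convex functions $f:[0,\infty)\to\mathbb R$ with $f(1)=0$ that are strictly convex at $1$, i.e. $tf(x)+(1-t)f(y)>0$ whenever $x\neq y$ in $[0,\infty)$, $t\in(0,1)$ and $tx+(1-t)y=1$. For a class $\mathcal C$ of Borel subsets of $\mathbb R$ and a Borel probability measure $\nu$ on $\mathbb R$ put $$G(\mathcal C)=\{g\in L^2(\nu): \{g>r\}\in\mathcal C\text{ for all } r\in\mathbb R\},$$ where elements of $L^2(\nu)$, and hence their superlevel sets, are taken modulo $\nu$-null sets. Let $\operatorname{proj}_{G(\mathcal C)}$ denote the metric projection (nearest point map) of $L^2(\nu)$ onto $G(\mathcal C)$. Call $\mathcal C$ a *pre-Glivenko–Cantelli class* if, for every Borel probability measure $\nu$, $G(\mathcal C)$ is a nonempty closed convex cone in $L^2(\nu)$ and, for all Borel probability measures $\mu\ll\nu$ with $\frac{d\mu}{d\nu}\in L^2(\nu)$, $$\sup_{A\in\mathcal C}\bigl(\mu(A)-\nu(A)\bigr)=\int\frac12\Bigl|\operatorname{proj}_{G(\mathcal C)}\frac{d\mu}{d\nu}-1\Bigr|\,d\nu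 .$$ For such $\mathcal C$, $f\in\mathcal F$ and $\mu\ll\nu$ with $\frac{d\mu}{d\nu}\in L^2(\nu)$ the $f$-divergence over $\mathcal C$ is $$D_f^{\mathcal C}(\mu\,\|\,\nu)=\int f\Bigl(\operatorname{proj}_{G(\mathcal C)}\frac{d\mu}{d\nu}\Bigr)d\nu .$$ The VC dimension of $\mathcal C$ is the largest number of points that $\mathcal C$ shatters. **Theorem 6.4 (Vapnik–Chervonenkis theorem for $f$-divergence).** Let $f\in\mathcal F$ and let $\mathcal C$ be a pre-Glivenko–Cantelli class of finite VC dimension. Let $\nu$ be a Borel probability measure on $\mathbb R$, let $X_1,X_2,\dots$ be independent random variables with law $\nu$ and let $\nu_n=\frac1n\sum_{i=1}^n\delta_{X_i}$ be the empirical measures. Then, almost surely, both of the following hold. 1. If $\nu_n\ll\nu$ for all sufficiently large $n$, and the derivatives $\frac{d\nu_n}{d\nu}$, or at least their projections $\operatorname{proj}_{G(\mathcal C)}\frac{d\nu_n}{d\nu}$, are bounded above $\nu$-almost everywhere by a constant independent of $n$ for all sufficiently large $n$, then $\lim_{n\to\infty}D_f^{\mathcal C}(\nu_n\,\|\,\nu)=0$.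 2. If $\nu\ll\nu_n$ for all sufficiently large $n$, then $\lim_{n\to\infty}D_f^{\mathcal C}(\nu\,\|\,\nu_n)=0$. -/

import Mathlib

open MeasureTheory ProbabilityTheory Filter Topology
open scoped ENNReal

/-- The class `𝓕` of generators of divergences: real functions on `[0, ∞)` that are convex, vanish
at `1` and are strictly convex at `1`. Only the values of `f` on `[0, ∞)` are constrained. -/
structure IsDivergenceGenerator (f : ℝ → ℝ) : Prop where
  convexOn : ConvexOn ℝ (Set.Ici 0) f
  map_one : f 1 = 0
  strict_at_one : ∀ x y t : ℝ, 0 ≤ x → 0 ≤ y → x ≠ y → 0 < t → t < 1 →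
    t * x + (1 - t) * y = 1 → 0 < t * f x + (1 - t) * f y

/-- `p` is a point of `K` closest to `x`. -/
def IsNearestPoint {E : Type*} [NormedAddCommGroup E] (K : Set E) (x p : E) : Prop :=
  p ∈ K ∧ ∀ q ∈ K, ‖x - p‖ ≤ ‖x - q‖

open Classical in
/-- Metric projection onto `K`: the point of `K` closest to `x` (it exists and is unique when `K` is
a nonempty closed convex subset of a Hilbert space); the value `0` is used if there is none. -/
noncomputable def metricProj {E : Type*} [NormedAddCommGroup E] (K : Set E) (x : E) : E :=
  if h : ∃ p, IsNearestPoint K x p then h.choose else 0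

/-- `G(𝒞)`: the elements `g` of `L²(ν)` all of whose superlevel sets `{g > r}` belong to `𝒞`.
As `g` is a class of functions modulo `ν`-null sets, membership of `{g > r}` in `𝒞` is understood
up to a `ν`-null set. -/
def levelCone (C : Set (Set ℝ)) (ν : Measure ℝ) : Set (Lp ℝ 2 ν) :=
  {g | ∀ r : ℝ, ∃ A ∈ C, {x | r < g x} =ᵐ[ν] A}

/-- The Radon-Nikodym derivative `dμ/dν` as a real function (meaningful when `μ ≪ ν`). -/
noncomputable def density (μ ν : Measure ℝ) : ℝ → ℝ := fun x => (μ.rnDeriv ν x).toReal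

open Classical in
/-- The projection of `dμ/dν` onto `G(𝒞)` in `L²(ν)`. It is only meaningful when `dμ/dν` belongs to
`L²(ν)`; otherwise the value is `0`. -/
noncomputable def projDensity (C : Set (Set ℝ)) (μ ν : Measure ℝ) : Lp ℝ 2 ν :=
  if h : MemLp (density μ ν) 2 ν then metricProj (levelCone C ν) (h.toLp (density μ ν)) else 0

/-- The `f`-divergence over `𝒞`, for `μ ≪ ν` with `dμ/dν` in `L²(ν)`. -/
noncomputable def divergenceOver (f : ℝ → ℝ) (C : Set (Set ℝ)) (μ ν : Measure ℝ) : ℝ :=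
  ∫ x, f (projDensity C μ ν x) ∂ν

/-- A pre-Glivenko-Cantelli class of Borel subsets of the line: for every Borel probability measure
`ν` the set `G(𝒞)` is a (nonempty) closed convex cone in `L²(ν)`, and for all Borel probability
measures `μ ≪ ν` with `dμ/dν` in `L²(ν)`, so that the projection makes sense,
`sup_{A ∈ 𝒞} (μ(A) - ν(A)) = ∫ |proj_{G(𝒞)} (dμ/dν) - 1| / 2 dν`. -/
structure IsPreGlivenkoCantelli (C : Set (Set ℝ)) : Prop where
  measurableSet : ∀ A ∈ C, MeasurableSet A
  nonempty : ∀ (ν : Measure ℝ) [IsProbabilityMeasure ν], (levelCone C ν).Nonempty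
  isClosed : ∀ (ν : Measure ℝ) [IsProbabilityMeasure ν], IsClosed (levelCone C ν)
  convex : ∀ (ν : Measure ℝ) [IsProbabilityMeasure ν], Convex ℝ (levelCone C ν)
  smul_mem : ∀ (ν : Measure ℝ) [IsProbabilityMeasure ν] (c : ℝ), 0 < c →
    ∀ g ∈ levelCone C ν, c • g ∈ levelCone C ν
  sup_eq : ∀ (μ ν : Measure ℝ) [IsProbabilityMeasure μ] [IsProbabilityMeasure ν],
    μ ≪ ν → MemLp (density μ ν) 2 ν →
      sSup ((fun A => μ.real A - ν.real A) '' C) = ∫ x, |projDensity C μ ν x - 1| / 2 ∂ν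

/-- `𝒞` shatters the finite set `s`: every subset of `s` is cut out of `s` by a member of `𝒞`. -/
def ShattersFinset {α : Type*} (C : Set (Set α)) (s : Finset α) : Prop :=
  ∀ t : Set α, t ⊆ s → ∃ A ∈ C, (s : Set α) ∩ A = t

/-- The Vapnik-Chervonenkis dimension: the largest number of points that `𝒞` can shatter. -/
noncomputable def vcDimension {α : Type*} (C : Set (Set α)) : ℕ∞ :=
  ⨆ (s : Finset α) (_ : ShattersFinset C s), (s.card : ℕ∞)

/-- The empirical measure of the first `n` terms of the sequence `x` (for `n ≥ 1`). -/
noncomputable def empiricalMeasure (x : ℕ → ℝ) (n : ℕ) : Measure ℝ :=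
  (n : ℝ≥0∞)⁻¹ • ∑ i ∈ Finset.range n, Measure.dirac (x i)

/-! Either absolute continuity makes `ν` purely atomic. If `νₙ ≪ ν`, every sample point is an atom,
so `νₙ` gives the non-atoms mass zero, and by the strong law so does `ν`. If `ν ≪ νₙ` for a single
`n`, then `ν` lives on finitely many sample values. Almost surely the empirical mass of each of the
countably many atoms converges, and for a purely atomic limit this gives convergence in total
variation (`eventually_forall_abs_real_sub_le`).

The supremum over `C` is at most the total variation distance, so the defining identity of the class
sends the `L¹` distance from the projected density to `1` to zero. Convexity gives `|f x| ≤ K * |x -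
1|` on `[0, c]`, hence the divergence vanishes too, provided the projections stay in a fixed `[0,
c]`. This range comes from truncation stability of the cone: projecting preserves the bounds `0` and
`c` (`metricProj_mem_Icc`). -/

theorem IsDivergenceGenerator.exists_abs_le {f : ℝ → ℝ} (hf : IsDivergenceGenerator f) (c : ℝ) :
    ∃ K : ℝ, 0 ≤ K ∧ ∀ x, 0 ≤ x → x ≤ c → |f x| ≤ K * |x - 1| := by
  set M : ℝ := |c| + 2 with hM
  have hM2 : 2 ≤ M := by have := abs_nonneg c; linarith
  have comb : ∀ x y t : ℝ, 0 ≤ x → 0 ≤ y → 0 ≤ t → t ≤ 1 →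
      f (t * x + (1 - t) * y) ≤ t * f x + (1 - t) * f y := fun x y t hx hy h0 h1 => by
    simpa using hf.convexOn.2 (Set.mem_Ici.2 hx) (Set.mem_Ici.2 hy) h0 (sub_nonneg.2 h1)
      (by ring)
  -- Upper bounds are chords from `1` to `M` or `0`. Lower bounds write `1` as a convex combination
  -- of `x` with `0` (if `x ≥ 1`) or with `2` (if `x ≤ 1`), using `f 1 = 0`.
  refine ⟨|f 0| + |f 2| + |f M|, by positivity, fun x hx0 hxc => ?_⟩
  have h0 := abs_le.1 (le_refl |f 0|)
  have h2 := abs_le.1 (le_refl |f 2|)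
  have hm := abs_le.1 (le_refl |f M|)
  have h0' := abs_nonneg (f 0)
  have h2' := abs_nonneg (f 2)
  have hm' := abs_nonneg (f M)
  rcases le_total 1 x with h | h
  · have hxM : x ≤ M := by have := le_abs_self c; linarith
    have hup : f x ≤ (x - 1) * |f M| := by
      have hMp : 0 < M - 1 := by linarith
      have ht1 : (x - 1) / (M - 1) ≤ 1 := by rw [div_le_one hMp]; linarith
      have ht0 : 0 ≤ (x - 1) / (M - 1) := div_nonneg (by linarith) hMp.le
      have := comb M 1 ((x - 1) / (M - 1)) (by linarith) zero_le_one ht0 ht1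
      rw [hf.map_one, show (x - 1) / (M - 1) * M + (1 - (x - 1) / (M - 1)) * 1 = x by
        field_simp; ring] at this
      have h3 : (x - 1) / (M - 1) ≤ x - 1 := div_le_self (by linarith) (by linarith)
      calc f x ≤ (x - 1) / (M - 1) * f M := by linarith
        _ ≤ (x - 1) / (M - 1) * |f M| := by gcongr; exact hm.2
        _ ≤ (x - 1) * |f M| := by gcongr
    have hlo : -((x - 1) * |f 0|) ≤ f x := by
      have hxp : 0 < x := by linarith
      have := comb x 0 (1 / x) hx0 le_rfl (by positivity) (by rw [div_le_one hxp]; exact h)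
      rw [show 1 / x * x + (1 - 1 / x) * 0 = 1 by field_simp; ring, hf.map_one] at this
      have h3 : 0 ≤ f x + (x - 1) * f 0 := by
        have h4 := mul_nonneg hx0 this
        have h5 : x * (1 / x * f x + (1 - 1 / x) * f 0) = f x + (x - 1) * f 0 := by field_simp
        linarith
      nlinarith
    rw [abs_of_nonneg (by linarith : 0 ≤ x - 1), abs_le]
    constructor <;> nlinarith
  · have hup : f x ≤ (1 - x) * |f 0| := by
      have := comb 1 0 x zero_le_one le_rfl hx0 h
      rw [hf.map_one, show x * 1 + (1 - x) * 0 = x by ring] at this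
      nlinarith
    have hlo : -((1 - x) * |f 2|) ≤ f x := by
      have hp : 0 < 2 - x := by linarith
      have := comb x 2 (1 / (2 - x)) hx0 zero_le_two (by positivity)
        (by rw [div_le_one hp]; linarith)
      rw [show 1 / (2 - x) * x + (1 - 1 / (2 - x)) * 2 = 1 by field_simp; ring,
        hf.map_one] at this
      have h3 : 0 ≤ f x + (1 - x) * f 2 := by
        have h4 := mul_nonneg hp.le this
        have h5 : (2 - x) * (1 / (2 - x) * f x + (1 - 1 / (2 - x)) * f 2)
            = f x + (1 - x) * f 2 := by field_simp; ring
        linarith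
      nlinarith
    rw [abs_of_nonpos (by linarith : x - 1 ≤ 0), abs_le]
    constructor <;> nlinarith

/-! ### Projection onto the cone of level functions -/

theorem isNearestPoint_metricProj {E : Type*} [NormedAddCommGroup E] [InnerProductSpace ℝ E]
    [CompleteSpace E] {K : Set E} (hne : K.Nonempty) (hcl : IsClosed K) (hconv : Convex ℝ K)
    (x : E) : IsNearestPoint K x (metricProj K x) := by
  have h : ∃ p, IsNearestPoint K x p := by
    obtain ⟨v, hv, hmin⟩ := exists_norm_eq_iInf_of_complete_convex hne hcl.isComplete hconv x
    refine ⟨v, hv, fun q hq => ?_⟩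
    rw [hmin]
    exact ciInf_le ⟨0, Set.forall_mem_range.2 fun _ => norm_nonneg _⟩ (⟨q, hq⟩ : K)
  rw [metricProj, dif_pos h]
  exact h.choose_spec

theorem IsNearestPoint.inner_le_zero {E : Type*} [NormedAddCommGroup E] [InnerProductSpace ℝ E]
    {K : Set E} (hconv : Convex ℝ K) {x p : E} (h : IsNearestPoint K x p) {q : E} (hq : q ∈ K) :
    inner ℝ (x - p) (q - p) ≤ 0 := by
  refine (norm_eq_iInf_iff_real_inner_le_zero hconv h.1).1 ?_ q hq
  have : Nonempty K := ⟨⟨p, h.1⟩⟩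
  exact le_antisymm (le_ciInf fun w => h.2 w w.2)
    (ciInf_le ⟨0, Set.forall_mem_range.2 fun _ => norm_nonneg _⟩ (⟨p, h.1⟩ : K))

/-- Only positive scalings are assumed, so `0` is reached as the limit of `c • g` for `c ↓ 0`, by
closedness. Its superlevel sets put `∅` and the whole line in `C` up to null sets. -/
theorem IsPreGlivenkoCantelli.zero_mem {C : Set (Set ℝ)} (hC : IsPreGlivenkoCantelli C)
    (ν : Measure ℝ) [IsProbabilityMeasure ν] : (0 : Lp ℝ 2 ν) ∈ levelCone C ν := by
  obtain ⟨g, hg⟩ := hC.nonempty ν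
  have ht : Tendsto (fun c : ℝ => c • g) (𝓝[>] 0) (𝓝 ((0 : ℝ) • g)) :=
    ((continuous_id.smul continuous_const).tendsto 0).mono_left nhdsWithin_le_nhds
  rw [zero_smul] at ht
  exact (hC.isClosed ν).mem_of_tendsto ht
    (eventually_mem_nhdsWithin.mono fun c hc => hC.smul_mem ν c hc g hg)

theorem IsPreGlivenkoCantelli.exists_ae_eq_empty {C : Set (Set ℝ)} (hC : IsPreGlivenkoCantelli C)
    (ν : Measure ℝ) [IsProbabilityMeasure ν] : ∃ A ∈ C, (∅ : Set ℝ) =ᵐ[ν] A := by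
  obtain ⟨A, hA, h⟩ := hC.zero_mem ν 0
  refine ⟨A, hA, EventuallyEq.trans ?_ h⟩
  exact eventuallyEq_set.2 (ae_of_all _ fun x => by simp)

theorem IsPreGlivenkoCantelli.exists_ae_eq_univ {C : Set (Set ℝ)} (hC : IsPreGlivenkoCantelli C)
    (ν : Measure ℝ) [IsProbabilityMeasure ν] : ∃ A ∈ C, (Set.univ : Set ℝ) =ᵐ[ν] A := by
  obtain ⟨A, hA, h⟩ := hC.zero_mem ν (-1)
  refine ⟨A, hA, EventuallyEq.trans ?_ h⟩
  exact eventuallyEq_set.2 (ae_of_all _ fun x => by simp)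

/-- The cone `G(𝒞)` is stable under truncation to `[0, c]`. -/
theorem IsPreGlivenkoCantelli.mem_levelCone_of_ae_eq_truncation {C : Set (Set ℝ)}
    (hC : IsPreGlivenkoCantelli C) {ν : Measure ℝ} [IsProbabilityMeasure ν] {p q : Lp ℝ 2 ν}
    (hp : p ∈ levelCone C ν) {c : ℝ} (hq : ∀ᵐ x ∂ν, q x = max 0 (min (p x) c)) :
    q ∈ levelCone C ν := by
  intro r
  rcases lt_or_ge r 0 with hr | hr
  · obtain ⟨A, hA, h⟩ := hC.exists_ae_eq_univ ν
    refine ⟨A, hA, EventuallyEq.trans ?_ h⟩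
    rw [eventuallyEq_set]
    filter_upwards [hq] with x hx
    simp [hx, hr]
  rcases le_or_gt c r with hcr | hcr
  · obtain ⟨A, hA, h⟩ := hC.exists_ae_eq_empty ν
    refine ⟨A, hA, EventuallyEq.trans ?_ h⟩
    rw [eventuallyEq_set]
    filter_upwards [hq] with x hx
    simp only [hx, Set.mem_empty_iff_false, iff_false, not_lt]
    exact max_le hr ((min_le_right _ _).trans hcr)
  · obtain ⟨A, hA, h⟩ := hp r
    refine ⟨A, hA, EventuallyEq.trans ?_ h⟩
    rw [eventuallyEq_set]
    filter_upwards [hq] with x hx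
    simp [hx, hr.not_gt, hcr]

/-- The projection onto `G(𝒞)` of a function with values in `[0, c]` has values in `[0, c]`. -/
theorem IsPreGlivenkoCantelli.metricProj_mem_Icc {C : Set (Set ℝ)}
    (hC : IsPreGlivenkoCantelli C) {ν : Measure ℝ} [IsProbabilityMeasure ν] {u : Lp ℝ 2 ν}
    {c : ℝ} (hu : ∀ᵐ x ∂ν, u x ∈ Set.Icc 0 c) :
    ∀ᵐ x ∂ν, metricProj (levelCone C ν) u x ∈ Set.Icc 0 c := by
  have hnear := isNearestPoint_metricProj (hC.nonempty ν) (hC.isClosed ν) (hC.convex ν) u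
  set p := metricProj (levelCone C ν) u
  have hc : 0 ≤ c := by
    obtain ⟨x, hx⟩ := hu.exists
    exact hx.1.trans hx.2
  have hmem : MemLp (fun x => max 0 (min (p x) c)) 2 ν := by
    refine MemLp.of_bound (aestronglyMeasurable_const.sup
      ((Lp.aestronglyMeasurable p).inf aestronglyMeasurable_const)) c (ae_of_all _ fun x => ?_)
    rw [Real.norm_of_nonneg (le_max_left _ _)]
    exact max_le hc (min_le_right _ _)
  set q : Lp ℝ 2 ν := hmem.toLp
  have hq : ∀ᵐ x ∂ν, q x = max 0 (min (p x) c) := hmem.coeFn_toLp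
  have hinner := hnear.inner_le_zero (hC.convex ν)
    (hC.mem_levelCone_of_ae_eq_truncation hnear.1 hq)
  -- Pointwise `(u - q) * (q - p) ≥ 0`, as `q` clips `p` to an interval containing `u`. With the
  -- variational inequality this forces `q = p`.
  have hnorm : inner ℝ (q - p) (q - p) ≤ inner ℝ (u - p) (q - p) := by
    rw [L2.inner_def, L2.inner_def]
    refine integral_mono_ae (L2.integrable_inner _ _) (L2.integrable_inner _ _) ?_
    filter_upwards [hu, hq, Lp.coeFn_sub q p, Lp.coeFn_sub u p] with x hux hqx h1 h2
    simp only [h1, h2, Pi.sub_apply, hqx, RCLike.inner_apply, conj_trivial]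
    obtain ⟨h3, h4⟩ := hux
    rcases le_total (p x) 0 with h | h
    · rw [min_eq_left (h.trans hc), max_eq_left h]
      nlinarith
    rcases le_total (p x) c with h' | h'
    · rw [min_eq_left h', max_eq_right h]
      simp
    · rw [min_eq_right h', max_eq_right hc]
      nlinarith
  have hqp : q = p := sub_eq_zero.1 (real_inner_self_nonpos.1 (hnorm.trans hinner))
  filter_upwards [hq] with x hx
  rw [← hqp, hx]
  exact ⟨le_max_left _ _, max_le hc (min_le_right _ _)⟩

theorem IsPreGlivenkoCantelli.projDensity_mem_Icc {C : Set (Set ℝ)}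
    (hC : IsPreGlivenkoCantelli C) {μ ν : Measure ℝ} [IsProbabilityMeasure ν] {c : ℝ}
    (hbd : ∀ᵐ x ∂ν, density μ ν x ≤ c) :
    MemLp (density μ ν) 2 ν ∧ ∀ᵐ x ∂ν, projDensity C μ ν x ∈ Set.Icc 0 c := by
  have hmem : MemLp (density μ ν) 2 ν := by
    refine MemLp.of_bound (Measure.measurable_rnDeriv μ ν).ennreal_toReal.aestronglyMeasurable c ?_
    filter_upwards [hbd] with x hx
    rwa [Real.norm_of_nonneg (show 0 ≤ density μ ν x from ENNReal.toReal_nonneg)]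
  refine ⟨hmem, ?_⟩
  rw [projDensity, dif_pos hmem]
  refine hC.metricProj_mem_Icc ?_
  filter_upwards [hmem.coeFn_toLp, hbd] with x hx hx'
  rw [hx]
  exact ⟨ENNReal.toReal_nonneg, hx'⟩

theorem IsPreGlivenkoCantelli.abs_divergenceOver_le {f : ℝ → ℝ} {C : Set (Set ℝ)}
    (hC : IsPreGlivenkoCantelli C) {μ ν : Measure ℝ} [IsProbabilityMeasure μ]
    [IsProbabilityMeasure ν] (hμν : μ ≪ ν) (hmem : MemLp (density μ ν) 2 ν) {c K ε : ℝ}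
    (hproj : ∀ᵐ x ∂ν, projDensity C μ ν x ∈ Set.Icc 0 c) (hK : 0 ≤ K)
    (hf : ∀ x, 0 ≤ x → x ≤ c → |f x| ≤ K * |x - 1|) (hε : 0 ≤ ε)
    (htv : ∀ A, MeasurableSet A → μ.real A - ν.real A ≤ ε) :
    |divergenceOver f C μ ν| ≤ 2 * K * ε := by
  have hsup : ∫ x, |projDensity C μ ν x - 1| / 2 ∂ν ≤ ε := by
    rw [← hC.sup_eq μ ν hμν hmem]
    refine Real.sSup_le ?_ hε
    rintro _ ⟨A, hA, rfl⟩
    exact htv A (hC.measurableSet A hA)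
  have hint : Integrable (fun x => 2 * K * (|projDensity C μ ν x - 1| / 2)) ν :=
    (((((Lp.memLp (projDensity C μ ν)).integrable one_le_two).sub
      (integrable_const 1)).abs).div_const 2).const_mul _
  calc |divergenceOver f C μ ν|
      ≤ ∫ x, 2 * K * (|projDensity C μ ν x - 1| / 2) ∂ν := by
        refine norm_integral_le_of_norm_le (G := ℝ) hint ?_
        filter_upwards [hproj] with x hx
        rw [Real.norm_eq_abs]
        linarith [hf _ hx.1 hx.2]
    _ ≤ 2 * K * ε := by
        rw [integral_const_mul]
        gcongr
-- Atoms and total variation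
theorem density_mul_real_singleton {μ ν : Measure ℝ} [IsProbabilityMeasure μ]
    [IsProbabilityMeasure ν] (hμν : μ ≪ ν) (x : ℝ) :
    density μ ν x * ν.real {x} = μ.real {x} := by
  have h := Measure.setLIntegral_rnDeriv hμν {x}
  rw [lintegral_singleton] at h
  rw [density, Measure.real, Measure.real, ← h, ENNReal.toReal_mul]

theorem countable_setOf_real_singleton_ne_zero (ν : Measure ℝ) [IsProbabilityMeasure ν] :
    {x : ℝ | ν.real {x} ≠ 0}.Countable := by
  refine (Measure.countable_meas_level_set_pos (μ := ν) measurable_id).mono fun x hx => ?_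
  have hx' : ν {x} ≠ 0 := fun h => hx (by simp [Measure.real, h])
  simpa [pos_iff_ne_zero] using hx'

/-- Pointwise convergence of the masses of the atoms of a purely atomic probability measure implies
convergence in total variation. -/
theorem eventually_forall_abs_real_sub_le {μ : ℕ → Measure ℝ} {ν : Measure ℝ}
    [IsProbabilityMeasure ν] (hμ : ∀ᶠ n in atTop, IsProbabilityMeasure (μ n)) {S : Set ℝ}
    (hS : S.Countable) (hνS : ν.real Sᶜ = 0)
    (hconv : ∀ x ∈ S, Tendsto (fun n => (μ n).real {x}) atTop (𝓝 (ν.real {x})))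
    {ε : ℝ} (hε : 0 < ε) :
    ∀ᶠ n in atTop, ∀ A, MeasurableSet A → |(μ n).real A - ν.real A| ≤ ε := by
  obtain ⟨F, hFS, hF⟩ : ∃ F : Finset ℝ, (F : Set ℝ) ⊆ S ∧ 1 - ε / 4 < ν.real F := by
    have : Countable S := hS.to_subtype
    have hmono : Monotone fun F : Finset S => (F : Set S).image Subtype.val :=
      fun F G h => Set.image_mono (by exact_mod_cast h)
    have hlim := tendsto_measure_iUnion_atTop (μ := ν) hmono
    have hU : ⋃ F : Finset S, (F : Set S).image Subtype.val = S := by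
      ext x
      simp only [Set.mem_iUnion]
      exact ⟨fun ⟨F, y, _, hy⟩ => hy ▸ y.2, fun hx => ⟨{⟨x, hx⟩}, ⟨x, hx⟩, by simp⟩⟩
    rw [hU] at hlim
    have hS1 : (ν S).toReal = 1 := by
      have := probReal_compl_eq_one_sub (μ := ν) hS.measurableSet
      rw [hνS, Measure.real] at this
      linarith
    have hlim' := (ENNReal.tendsto_toReal (measure_ne_top ν S)).comp hlim
    rw [hS1] at hlim'
    obtain ⟨F, hF⟩ := (hlim'.eventually (lt_mem_nhds (show 1 - ε / 4 < 1 by linarith))).exists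
    classical
    refine ⟨F.image Subtype.val, ?_, ?_⟩
    · rw [Finset.coe_image]
      rintro _ ⟨y, _, rfl⟩
      exact y.2
    · rw [Finset.coe_image]
      exact hF
  have hsum : Tendsto (fun n => ∑ x ∈ F, |(μ n).real {x} - ν.real {x}|) atTop (𝓝 0) := by
    rw [← Finset.sum_const_zero (s := F)]
    refine tendsto_finsetSum _ fun x hx => ?_
    simpa using ((hconv x (hFS hx)).sub_const (ν.real {x})).abs
  filter_upwards [hμ, hsum.eventually (gt_mem_nhds (show (0 : ℝ) < ε / 4 by positivity))]
    with n hn hlt A hA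
  -- Inside `F` the error is at most `ε / 4`. Outside, `ν` has mass below `ε / 4`, hence `μ n` below
  -- `ε / 2`.
  have key : ∀ B ⊆ (F : Set ℝ), |(μ n).real B - ν.real B| ≤ ε / 4 := by
    intro B hB
    lift B to Finset ℝ using F.finite_toSet.subset hB
    rw [← sum_measureReal_singleton, ← sum_measureReal_singleton, ← Finset.sum_sub_distrib]
    refine (Finset.abs_sum_le_sum_abs _ _).trans (le_trans ?_ hlt.le)
    exact Finset.sum_le_sum_of_subset_of_nonneg (by exact_mod_cast hB) fun _ _ _ => abs_nonneg _
  have h1 := abs_le.1 (key _ (Set.inter_subset_right (s := A)))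
  have h2 := abs_le.1 (key _ subset_rfl)
  have hFm : MeasurableSet (F : Set ℝ) := F.measurableSet
  have h3 := measureReal_inter_add_sdiff (μ := μ n) (s := A) hFm
  have h4 := measureReal_inter_add_sdiff (μ := ν) (s := A) hFm
  have h5 := probReal_compl_eq_one_sub (μ := μ n) hFm
  have h6 := probReal_compl_eq_one_sub (μ := ν) hFm
  have h7 : (μ n).real (A \ F) ≤ (μ n).real (F : Set ℝ)ᶜ := measureReal_mono fun x hx => hx.2
  have h8 : ν.real (A \ F) ≤ ν.real (F : Set ℝ)ᶜ := measureReal_mono fun x hx => hx.2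
  have h9 : 0 ≤ (μ n).real (A \ F) := measureReal_nonneg
  have h10 : 0 ≤ ν.real (A \ F) := measureReal_nonneg
  rw [abs_le]
  constructor <;> linarith

/-! ### Empirical measures -/

theorem empiricalMeasure_real_apply (x : ℕ → ℝ) (n : ℕ) {B : Set ℝ} (hB : MeasurableSet B) :
    (empiricalMeasure x n).real B = (∑ i ∈ Finset.range n, B.indicator 1 (x i)) / n := by
  have h : ∀ i, (Measure.dirac (x i) B).toReal = B.indicator (1 : ℝ → ℝ) (x i) := fun i => by
    rw [Measure.dirac_apply' _ hB]
    by_cases hi : x i ∈ B <;> simp [hi]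
  rw [Measure.real, empiricalMeasure, Measure.smul_apply, Measure.finsetSum_apply, smul_eq_mul,
    ENNReal.toReal_mul, ENNReal.toReal_sum (fun i _ => measure_ne_top _ _), ENNReal.toReal_inv,
    ENNReal.toReal_natCast, div_eq_inv_mul]
  simp only [h]

theorem isProbabilityMeasure_empiricalMeasure (x : ℕ → ℝ) {n : ℕ} (hn : n ≠ 0) :
    IsProbabilityMeasure (empiricalMeasure x n) := by
  constructor
  rw [empiricalMeasure, Measure.smul_apply, Measure.finsetSum_apply]
  simp [ENNReal.inv_mul_cancel (Nat.cast_ne_zero.2 hn) (ENNReal.natCast_ne_top n)]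

theorem empiricalMeasure_real_singleton_pos (x : ℕ → ℝ) {n i : ℕ} (hi : i < n) :
    0 < (empiricalMeasure x n).real {x i} := by
  rw [empiricalMeasure_real_apply _ _ (measurableSet_singleton _)]
  refine div_pos ?_ (by exact_mod_cast (Nat.zero_le i).trans_lt hi)
  refine Finset.sum_pos' (fun j _ => Set.indicator_nonneg (fun _ _ => zero_le_one) _)
    ⟨i, Finset.mem_range.2 hi, by simp⟩

theorem empiricalMeasure_compl_image (x : ℕ → ℝ) (n : ℕ) :
    empiricalMeasure x n (x '' Set.Iio n)ᶜ = 0 := by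
  have hB : MeasurableSet (x '' Set.Iio n)ᶜ :=
    ((Set.finite_Iio n).image x).measurableSet.compl
  rw [empiricalMeasure, Measure.smul_apply, Measure.finsetSum_apply, Finset.sum_eq_zero,
    smul_zero]
  intro i hi
  rw [Measure.dirac_apply' _ hB, Set.indicator_of_notMem]
  exact fun h => h ⟨i, Finset.mem_range.1 hi, rfl⟩

theorem ae_tendsto_empiricalMeasure_real {ν : Measure ℝ} {Ω : Type*} [MeasurableSpace Ω]
    {P : Measure Ω} [IsProbabilityMeasure P] {X : ℕ → Ω → ℝ} (hX : ∀ i, Measurable (X i))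
    (hlaw : ∀ i, P.map (X i) = ν) (hindep : iIndepFun X P) {B : Set ℝ} (hB : MeasurableSet B) :
    ∀ᵐ ω ∂P, Tendsto (fun n => (empiricalMeasure (fun i => X i ω) n).real B) atTop
      (𝓝 (ν.real B)) := by
  have hm : Measurable (B.indicator (1 : ℝ → ℝ)) := measurable_one.indicator hB
  have hint : Integrable (B.indicator (1 : ℝ → ℝ) ∘ X 0) P := by
    refine Integrable.of_bound (hm.comp (hX 0)).aestronglyMeasurable 1 (ae_of_all _ fun ω => ?_)
    by_cases h : X 0 ω ∈ B <;> simp [h]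
  have hid : ∀ i, IdentDistrib (B.indicator (1 : ℝ → ℝ) ∘ X i)
      (B.indicator (1 : ℝ → ℝ) ∘ X 0) P P := fun i =>
    IdentDistrib.comp ⟨(hX i).aemeasurable, (hX 0).aemeasurable, by rw [hlaw, hlaw]⟩ hm
  have hslln := strong_law_ae_real (fun i => B.indicator (1 : ℝ → ℝ) ∘ X i) hint
    (fun i j hij => (hindep.indepFun hij).comp hm hm) hid
  have hE : ∫ ω, (B.indicator (1 : ℝ → ℝ) ∘ X 0) ω ∂P = ν.real B := by
    rw [← hlaw 0, ← integral_indicator_one hB,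
      integral_map (hX 0).aemeasurable hm.aestronglyMeasurable]
    rfl
  rw [hE] at hslln
  filter_upwards [hslln] with ω hω
  simpa only [empiricalMeasure_real_apply _ _ hB, Function.comp_apply] using hω

/-- A measure concentrated on a finite set has an essentially bounded density with respect to a
purely atomic measure dominating it. -/
theorem exists_forall_ae_density_le {μ ν : Measure ℝ} [IsProbabilityMeasure μ]
    [IsProbabilityMeasure ν] (hμν : μ ≪ ν) {T : Set ℝ} (hT : T.Finite) (hμT : μ Tᶜ = 0)
    (hatom : ν {x | ν.real {x} ≠ 0}ᶜ = 0) : ∃ c, ∀ᵐ x ∂ν, density μ ν x ≤ c := by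
  obtain ⟨c, hc⟩ := (hT.image (density μ ν)).bddAbove
  refine ⟨max c 0, ?_⟩
  filter_upwards [compl_mem_ae_iff.2 hatom] with x hx
  rw [compl_compl] at hx
  by_cases hxT : x ∈ T
  · exact (hc ⟨x, hxT, rfl⟩).trans (le_max_left _ _)
  · have h := density_mul_real_singleton hμν x
    have h0 : μ.real {x} = 0 := by
      rw [Measure.real, measure_mono_null (Set.singleton_subset_iff.2 hxT) hμT,
        ENNReal.toReal_zero]
    rw [h0] at h
    exact ((mul_eq_zero.1 h).resolve_right hx).le.trans (le_max_right _ _)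

theorem real_singleton_eq_zero_iff {ν : Measure ℝ} [IsProbabilityMeasure ν] {x : ℝ} :
    ν.real {x} = 0 ↔ ν {x} = 0 := by
  simp [Measure.real, ENNReal.toReal_eq_zero_iff]

theorem measure_compl_atoms_eq_zero {ν : Measure ℝ} [IsProbabilityMeasure ν] {T : Set ℝ}
    (hT : T.Countable) (hνT : ν Tᶜ = 0) : ν {x | ν.real {x} ≠ 0}ᶜ = 0 := by
  have h : ν (T ∩ {x | ν.real {x} ≠ 0}ᶜ) = 0 := by
    rw [← Set.biUnion_of_singleton (T ∩ _),
      measure_biUnion_null_iff (hT.mono Set.inter_subset_left)]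
    rintro x ⟨_, hx⟩
    exact real_singleton_eq_zero_iff.1 (not_not.1 hx)
  refine measure_mono_null (fun x hx => ?_) (measure_union_null h hνT)
  by_cases hxT : x ∈ T
  · exact Or.inl ⟨hxT, hx⟩
  · exact Or.inr hxT

/-! ### From total variation to divergence -/

theorem tendsto_divergenceOver_zero {f : ℝ → ℝ} (hf : IsDivergenceGenerator f) {C : Set (Set ℝ)}
    (hC : IsPreGlivenkoCantelli C) {μ ν : ℕ → Measure ℝ} {c : ℝ}
    (hμ : ∀ᶠ n in atTop, IsProbabilityMeasure (μ n))
    (hν : ∀ᶠ n in atTop, IsProbabilityMeasure (ν n)) (hac : ∀ᶠ n in atTop, μ n ≪ ν n)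
    (hmem : ∀ᶠ n in atTop, MemLp (density (μ n) (ν n)) 2 (ν n))
    (hproj : ∀ᶠ n in atTop, ∀ᵐ x ∂ν n, projDensity C (μ n) (ν n) x ∈ Set.Icc 0 c)
    (htv : ∀ ε > 0, ∀ᶠ n in atTop, ∀ A, MeasurableSet A → (μ n).real A - (ν n).real A ≤ ε) :
    Tendsto (fun n => divergenceOver f C (μ n) (ν n)) atTop (𝓝 0) := by
  obtain ⟨K, hK, hfK⟩ := hf.exists_abs_le c
  rw [Metric.tendsto_nhds]
  intro ε hε
  have hδ : 0 < ε / (2 * K + 1) := by positivity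
  filter_upwards [hμ, hν, hac, hmem, hproj, htv _ hδ] with n h1 h2 h3 h4 h5 h6
  rw [dist_zero_right, Real.norm_eq_abs]
  refine (hC.abs_divergenceOver_le h3 h4 h5 hK hfK hδ.le h6).trans_lt ?_
  rw [← mul_div_assoc, div_lt_iff₀ (by positivity)]
  nlinarith

theorem measure_compl_atoms_eq_zero_of_empiricalMeasure_absolutelyContinuous {x : ℕ → ℝ}
    {ν : Measure ℝ} [IsProbabilityMeasure ν]
    (hlim : Tendsto (fun n => (empiricalMeasure x n).real {y | ν.real {y} ≠ 0}ᶜ) atTop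
      (𝓝 (ν.real {y | ν.real {y} ≠ 0}ᶜ)))
    (hac : ∀ᶠ n in atTop, empiricalMeasure x n ≪ ν) : ν {y | ν.real {y} ≠ 0}ᶜ = 0 := by
  have hzero : ∀ᶠ n in atTop, (empiricalMeasure x n).real {y | ν.real {y} ≠ 0}ᶜ = 0 := by
    filter_upwards [hac] with n hn
    rw [Measure.real, measure_mono_null (Set.compl_subset_compl.2 ?_)
      (empiricalMeasure_compl_image x n), ENNReal.toReal_zero]
    rintro _ ⟨i, hi, rfl⟩ h0
    have := hn (real_singleton_eq_zero_iff.1 h0)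
    exact (empiricalMeasure_real_singleton_pos x hi).ne' (by simp [Measure.real, this])
  have h := tendsto_nhds_unique hlim
    (tendsto_const_nhds.congr' (hzero.mono fun n hn => hn.symm))
  exact (measureReal_eq_zero_iff).1 h

/-- On a sample point the density is a ratio of masses: zero off the atoms of `ν`, and tending to
`1` on each of the finitely many atoms, so any bound above `1` would do. -/
theorem eventually_ae_density_empiricalMeasure_le_two {x : ℕ → ℝ} {ν : Measure ℝ}
    [IsProbabilityMeasure ν] (hfin : {y | ν.real {y} ≠ 0}.Finite)
    (hlim : ∀ y ∈ {y | ν.real {y} ≠ 0},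
      Tendsto (fun n => (empiricalMeasure x n).real {y}) atTop (𝓝 (ν.real {y})))
    (hac : ∀ᶠ n in atTop, ν ≪ empiricalMeasure x n) :
    ∀ᶠ n in atTop, ∀ᵐ y ∂empiricalMeasure x n, density ν (empiricalMeasure x n) y ≤ 2 := by
  have hev : ∀ᶠ n in atTop, ∀ y ∈ {y | ν.real {y} ≠ 0},
      ν.real {y} < 2 * (empiricalMeasure x n).real {y} := by
    rw [eventually_all_finite hfin]
    intro y hy
    have hpos : 0 < ν.real {y} := measureReal_nonneg.lt_of_ne' hy
    exact ((hlim y hy).const_mul 2).eventually (lt_mem_nhds (by linarith))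
  filter_upwards [hev, hac, eventually_ne_atTop 0] with n hn hacn hn0
  have := isProbabilityMeasure_empiricalMeasure x hn0
  filter_upwards [compl_mem_ae_iff.2 (empiricalMeasure_compl_image x n)] with y hy
  rw [compl_compl] at hy
  obtain ⟨i, hi, rfl⟩ := hy
  have hpos := empiricalMeasure_real_singleton_pos x hi
  have hd := density_mul_real_singleton hacn (x i)
  refine le_of_mul_le_mul_right ?_ hpos
  rw [hd]
  by_cases h0 : ν.real {x i} = 0
  · rw [h0]; positivity
  · exact (hn _ h0).le

theorem theorem6p4 (f : ℝ → ℝ) (hf : IsDivergenceGenerator f)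
    (C : Set (Set ℝ)) (hC : IsPreGlivenkoCantelli C) (hVC : vcDimension C < ⊤)
    (ν : Measure ℝ) [IsProbabilityMeasure ν]
    {Ω : Type*} [MeasurableSpace Ω] (P : Measure Ω) [IsProbabilityMeasure P]
    (X : ℕ → Ω → ℝ) (hX : ∀ i, Measurable (X i)) (hlaw : ∀ i, P.map (X i) = ν)
    (hindep : iIndepFun X P) :
    ∀ᵐ ω ∂P,
      ((∀ᶠ n in atTop, empiricalMeasure (fun i => X i ω) n ≪ ν) →
        ((∃ c : ℝ, ∀ᶠ n in atTop,
            ∀ᵐ x ∂ν, density (empiricalMeasure (fun i => X i ω) n) ν x ≤ c) ∨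
          (∃ c : ℝ, ∀ᶠ n in atTop,
            ∀ᵐ x ∂ν, projDensity C (empiricalMeasure (fun i => X i ω) n) ν x ≤ c)) →
        Tendsto (fun n => divergenceOver f C (empiricalMeasure (fun i => X i ω) n) ν)
          atTop (𝓝 0)) ∧
      ((∀ᶠ n in atTop, ν ≪ empiricalMeasure (fun i => X i ω) n) →
        Tendsto (fun n => divergenceOver f C ν (empiricalMeasure (fun i => X i ω) n))
          atTop (𝓝 0)) := by
  have hatoms := countable_setOf_real_singleton_ne_zero ν
  filter_upwards [(ae_ball_iff hatoms).2 fun x _ =>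
      ae_tendsto_empiricalMeasure_real hX hlaw hindep (measurableSet_singleton x),
    ae_tendsto_empiricalMeasure_real hX hlaw hindep hatoms.measurableSet.compl] with ω hpt hcompl
  have hprob : ∀ᶠ n in atTop, IsProbabilityMeasure (empiricalMeasure (fun i => X i ω) n) :=
    (eventually_ne_atTop 0).mono fun n hn => isProbabilityMeasure_empiricalMeasure _ hn
  have htv : ν {x | ν.real {x} ≠ 0}ᶜ = 0 → ∀ ε > 0, ∀ᶠ n in atTop, ∀ A, MeasurableSet A →
      |(empiricalMeasure (fun i => X i ω) n).real A - ν.real A| ≤ ε := fun h0 ε hε =>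
    eventually_forall_abs_real_sub_le hprob hatoms (by rw [Measure.real, h0, ENNReal.toReal_zero])
      hpt hε
  refine ⟨fun hac hbound => ?_, fun hac => ?_⟩
  · have h0 := measure_compl_atoms_eq_zero_of_empiricalMeasure_absolutelyContinuous hcompl hac
    -- This bound may depend on `n`. It supplies square integrability and nonnegative projections
    -- even when only the projections are uniformly bounded.
    have hbd : ∀ᶠ n in atTop, ∃ c, ∀ᵐ x ∂ν,
        density (empiricalMeasure (fun i => X i ω) n) ν x ≤ c := by
      filter_upwards [hac, hprob] with n hn hp
      exact exists_forall_ae_density_le hn ((Set.finite_Iio n).image _)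
        (empiricalMeasure_compl_image _ n) h0
    have hmem : ∀ᶠ n in atTop,
        MemLp (density (empiricalMeasure (fun i => X i ω) n) ν) 2 ν := by
      filter_upwards [hbd, hprob] with n ⟨c, hc⟩ hp
      exact (hC.projDensity_mem_Icc hc).1
    obtain ⟨c, hproj⟩ : ∃ c, ∀ᶠ n in atTop, ∀ᵐ x ∂ν,
        projDensity C (empiricalMeasure (fun i => X i ω) n) ν x ∈ Set.Icc 0 c := by
      rcases hbound with ⟨c, hc⟩ | ⟨c, hc⟩
      · refine ⟨c, ?_⟩
        filter_upwards [hc, hprob] with n hn hp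
        exact (hC.projDensity_mem_Icc hn).2
      · refine ⟨c, ?_⟩
        filter_upwards [hc, hbd, hprob] with n hn ⟨c', hc'⟩ hp
        filter_upwards [hn, (hC.projDensity_mem_Icc hc').2] with x hx hx'
        exact ⟨hx'.1, hx⟩
    exact tendsto_divergenceOver_zero hf hC (ν := fun _ => ν) hprob (Eventually.of_forall
      fun _ => inferInstance) hac hmem hproj fun ε hε =>
        (htv h0 ε hε).mono fun n hn A hA => (abs_le.1 (hn A hA)).2
  · obtain ⟨N, hN⟩ := hac.exists
    have hT : ((fun i => X i ω) '' Set.Iio N).Finite := (Set.finite_Iio N).image _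
    have hνT := hN (empiricalMeasure_compl_image (fun i => X i ω) N)
    have h0 := measure_compl_atoms_eq_zero hT.countable hνT
    have hfin : {x | ν.real {x} ≠ 0}.Finite := hT.subset fun x hx => by
      by_contra hxT
      exact hx (real_singleton_eq_zero_iff.2
        (measure_mono_null (Set.singleton_subset_iff.2 hxT) hνT))
    have hbd := eventually_ae_density_empiricalMeasure_le_two hfin hpt hac
    refine tendsto_divergenceOver_zero hf hC (μ := fun _ => ν) (c := 2) (Eventually.of_forall
      fun _ => inferInstance) hprob hac ?_ ?_ fun ε hε =>
        (htv h0 ε hε).mono fun n hn A hA => by linarith [(abs_le.1 (hn A hA)).1]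
    · filter_upwards [hbd, hprob] with n hn hp
      exact (hC.projDensity_mem_Icc hn).1
    · filter_upwards [hbd, hprob] with n hn hp
      exact (hC.projDensity_mem_Icc hn).2
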